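/- Let $p$ be a prime different from $2$, and let $|\cdot|_p$ be the $p$-adic norm on $\mathbb{Q}_p$, $\|x\|_p=\max_{1\le i\le 4}|x_i|_p$ on $\mathbb{Q}_p^4$, and $d^4\xi$ the Haar measure on $\mathbb{Q}_p^4$ giving the unit ball $\mathbb{Z}_p^4$ volume $1$. Let $\chi(y)=\exp(2\pi i\{y\}_p)$, where $\{y\}_p$ is the $p$-adic fractional part of $y\in\mathbb{Q}_p$. Let $a\in\mathbb{Z}$ be a quadratic non-residue modulo $p$ and put $$f(x)=x_1^2-ax_2^2-px_3^2+apx_4^2,\qquad f^{\circ}(\xi)=ap\,\xi_1^2-p\,\xi_2^2-a\,\xi_3^2+\xi_4^2 .$$ For real $\alpha>0$, $\kappa>0$, $t>0$ and $x\in\mathbb{Q}_p^4$ define the heat kernel $$Z(x,t)=\int_{\mathbb{Q}_p^4}\chi(\xi\cdot x)\,e^{-\kappa t|f^{\circ}(\xi)|_p^{\alpha}}\,d^4\xi,\qquad \xi\cdot x=\sum_{j=1}^4\xi_jx_j .$$ This integral converges absolutely, and the following assertions hold. (i) $|f(x+\xi)|_p=|f(x)|_p$ for all $x\in\mathbb{Q}_p^4\setminus\{0\}$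 and $\xi\in\mathbb{Q}_p^4$ with $\|\xi\|_p<p^{-1}\|x\|_p$. (ii) For all $x\in\mathbb{Q}_p^4\setminus\{0\}$ and $t>0$, $$Z(x,t)=\sum_{m=1}^{\infty}\frac{(-1)^m}{m!}\left(\frac{1-p^{\alpha m}}{1-p^{-\alpha m-2}}\right)\kappa^mt^m|f(x)|_p^{-\alpha m-2},$$ where the series converges absolutely. (iii) $Z(x+\xi,t)=Z(x,t)$ for all $x\in\mathbb{Q}_p^4\setminus\{0\}$, $t>0$ and $\xi\in\mathbb{Q}_p^4$ with $\|\xi\|_p<p^{-1}\|x\|_p$; so $Z(\cdot,t)$ is locally constant away from $0$. (iv) $Z(x,t)$ is real and $Z(x,t)\ge 0$ for all $x\in\mathbb{Q}_p^4$ and $t>0$. -/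

import Mathlib

open MeasureTheory

noncomputable section

namespace PadicHeat

variable (p : ℕ) [Fact p.Prime]

/-- `ℚ_[p]` carries its Borel σ-algebra. -/
instance instMeasurableSpacePadic : MeasurableSpace ℚ_[p] := borel ℚ_[p]

instance instBorelSpacePadic : BorelSpace ℚ_[p] := ⟨rfl⟩

/-- `ℚ_p⁴`.  The norm of this type is the maximum of the `p`-adic norms of the coordinates. -/
abbrev Space : Type := Fin 4 → ℚ_[p]

/-- The closed unit ball `ℤ_p⁴` of `ℚ_p⁴`. -/
def unitBall : TopologicalSpace.PositiveCompacts (Space p) where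
  carrier := Metric.closedBall 0 1
  isCompact' := isCompact_closedBall 0 1
  interior_nonempty' :=
    ⟨0, mem_interior_iff_mem_nhds.mpr (Metric.closedBall_mem_nhds 0 one_pos)⟩

/-- The Haar measure `d⁴x` of `ℚ_p⁴`, normalized so that the closed unit ball has volume `1`. -/
def haar : Measure (Space p) := Measure.addHaarMeasure (unitBall p)

variable {p}

/-- The least natural number `n` such that `p ^ n * x` is a `p`-adic integer:
`-ord x` if `ord x < 0`, and `0` otherwise. -/
def poleOrder (x : ℚ_[p]) : ℕ := (-x.valuation).toNat

theorem norm_mul_pow_poleOrder_le (x : ℚ_[p]) : ‖x * (p : ℚ_[p]) ^ poleOrder x‖ ≤ 1 := by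
  by_cases hx : x = 0
  · simp [hx]
  have hp : (1 : ℝ) < p := by exact_mod_cast (Fact.out : p.Prime).one_lt
  rw [norm_mul, norm_pow, Padic.norm_p, Padic.norm_eq_zpow_neg_valuation hx, inv_pow,
    ← zpow_natCast, ← zpow_neg, ← zpow_add₀ (by positivity)]
  apply zpow_le_one_of_nonpos₀ hp.le
  unfold poleOrder
  omega

/-- The fractional part `{x}_p`: with `n = poleOrder x`, the truncation modulo `p ^ n` of the
`p`-adic integer `p ^ n * x` (a natural number less than `p ^ n`, whose base `p` digits are the
first `n` digits of `p ^ n * x`), divided by `p ^ n`.  It is `0` if `x` is a `p`-adic integer. -/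
def fractPart (x : ℚ_[p]) : ℚ :=
  ((PadicInt.toZModPow (poleOrder x)
      (⟨x * (p : ℚ_[p]) ^ poleOrder x, norm_mul_pow_poleOrder_le x⟩ : ℤ_[p])).val : ℚ)
    / (p : ℚ) ^ poleOrder x

/-- The standard additive character `χ(y) = exp (2 π i {y}_p)` of `ℚ_p`. -/
def chi (y : ℚ_[p]) : ℂ := Complex.exp (2 * Real.pi * Complex.I * ((fractPart y : ℚ) : ℂ))

/-- The quadratic form `f(x) = x₁² - a x₂² - p x₃² + a p x₄²`. -/
def form (a : ℤ) (x : Space p) : ℚ_[p] :=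
  x 0 ^ 2 - a * x 1 ^ 2 - p * x 2 ^ 2 + a * p * x 3 ^ 2

/-- The quadratic form `f°(ξ) = a p ξ₁² - p ξ₂² - a ξ₃² + ξ₄²`. -/
def dualForm (a : ℤ) (ξ : Space p) : ℚ_[p] :=
  a * p * ξ 0 ^ 2 - p * ξ 1 ^ 2 - a * ξ 2 ^ 2 + ξ 3 ^ 2

/-- The integrand `χ(ξ · x) exp (-κ t |f°(ξ)|_p ^ α)` of the heat kernel. -/
def heatIntegrand (a : ℤ) (α κ : ℝ) (x : Space p) (t : ℝ) (ξ : Space p) : ℂ :=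
  chi (∑ i, ξ i * x i) * ((Real.exp (-κ * t * ‖dualForm a ξ‖ ^ α) : ℝ) : ℂ)

/-- The heat kernel `Z(x, t) = ∫ χ(ξ · x) exp (-κ t |f°(ξ)|_p ^ α) d⁴ξ` attached to `f°`. -/
def heatKernel (a : ℤ) (α κ : ℝ) (x : Space p) (t : ℝ) : ℂ :=
  ∫ ξ, heatIntegrand a α κ x t ξ ∂(haar p)

end PadicHeat

end

noncomputable section

namespace PadicHeat

/-! ### The additive character of `ℚ_p`. -/

section Character

variable {p : ℕ} [Fact p.Prime]

/-! Since `a` is a non-residue, `y² - a z²` is anisotropic modulo `p`, and `|f(x)|` is the maximum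
of `|x₁|²`, `|x₂|²`, `p⁻¹|x₃|²`, `p⁻¹|x₄|²`. Hence `|f|` is ultrametric and lies between `p⁻¹‖x‖²`
and `‖x‖²`, which gives (i). The same holds for `f°`, which is `f` with the coordinates reversed, so
each set `L_n = {|f°| ≤ p ^ n}` is a lattice.

The heart is a duality: the annihilator of `L_n` under `χ(ξ · x)` is `{|f| ≤ p ^ (-n)}`, and `L_n`
has volume `p ^ (2n)`. Thus the Fourier transform of the indicator of `L_n` is `p ^ (2n)` times the
indicator of `{|f| ≤ p ^ (-n)}` (`setIntegral_chi`). Away from `0`, the Gaussian-like factor is a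
superposition of indicators of the `L_n` with the jumps `heatJump` as nonnegative coefficients.
Integrating term by term, `Z(x, t)` is the sum of `heatJump n * p ^ (2n)` over all `n` with `|f(x)|
≤ p ^ (-n)` (`hasSum_heatKernel`).

This gives (iv) at once. Expanding the exponentials in the jumps and summing geometric series over
`n` gives (ii) (`hasSum_heatJump_expansion`). The result depends on `x` only through `|f(x)|`, so
(iii) follows from (i). -/

theorem norm_sub_fractPart_le (x : ℚ_[p]) : ‖x - (fractPart x : ℚ_[p])‖ ≤ 1 := by
  have hp : (p : ℚ_[p]) ≠ 0 := by exact_mod_cast (Fact.out : p.Prime).ne_zero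
  set n := poleOrder x with hn
  set z : ℤ_[p] := ⟨x * (p : ℚ_[p]) ^ n, norm_mul_pow_poleOrder_le x⟩ with hz
  have hker : z - ((PadicInt.toZModPow n z).val : ℤ_[p]) ∈
      RingHom.ker (PadicInt.toZModPow n : ℤ_[p] →+* ZMod (p ^ n)) := by
    rw [RingHom.mem_ker, map_sub, map_natCast, ZMod.natCast_val, ZMod.cast_id, sub_self]
  rw [PadicInt.ker_toZModPow, Ideal.mem_span_singleton] at hker
  obtain ⟨w, hw⟩ := hker
  have hw' : x * (p : ℚ_[p]) ^ n - ((PadicInt.toZModPow n z).val : ℚ_[p]) =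
      (p : ℚ_[p]) ^ n * (w : ℚ_[p]) := by
    have := congrArg (fun y : ℤ_[p] => (y : ℚ_[p])) hw
    rw [PadicInt.coe_sub, PadicInt.coe_mul, PadicInt.coe_pow, PadicInt.coe_natCast,
      PadicInt.coe_natCast] at this
    exact this
  have : x - (fractPart x : ℚ_[p]) = w := by
    have h : (fractPart x : ℚ_[p]) = ((PadicInt.toZModPow n z).val : ℚ_[p]) / (p : ℚ_[p]) ^ n := by
      unfold fractPart
      push_cast
      rfl
    rw [h]
    field_simp
    linear_combination hw'
  rw [this]
  exact w.2

theorem exists_fractPart_eq (x : ℚ_[p]) : ∃ (m : ℤ) (n : ℕ), fractPart x = m / (p : ℚ) ^ n :=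
  ⟨_, poleOrder x, by unfold fractPart; rw [← Int.cast_natCast]⟩

/-- The only possible denominator is a power of `p`, and `p`-adic integrality removes it. This turns
congruences modulo `ℤ_p` into congruences of fractional parts modulo `ℤ`, which `exp (2πi ·)` does
not see. -/
theorem exists_int_eq_of_norm_le_one {q : ℚ} {m : ℤ} {n : ℕ} (hq : q = m / (p : ℚ) ^ n)
    (h : ‖(q : ℚ_[p])‖ ≤ 1) : ∃ z : ℤ, q = z := by
  have hp : (p : ℚ) ≠ 0 := by exact_mod_cast (Fact.out : p.Prime).ne_zero
  have hp' : (0 : ℝ) < p := by exact_mod_cast (Fact.out : p.Prime).pos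
  have : ‖(m : ℚ_[p])‖ ≤ (p : ℝ) ^ (-n : ℤ) := by
    rw [hq] at h
    push_cast at h
    rw [norm_div, norm_pow, Padic.norm_p, inv_pow, div_inv_eq_mul] at h
    rw [zpow_neg, zpow_natCast]
    rwa [← le_div_iff₀ (by positivity), one_div] at h
  rw [Padic.norm_int_le_pow_iff_dvd] at this
  obtain ⟨z, hz⟩ := this
  refine ⟨z, ?_⟩
  rw [hq, hz]
  push_cast
  field_simp

theorem exists_int_fractPart_add (x y : ℚ_[p]) :
    ∃ z : ℤ, fractPart (x + y) - fractPart x - fractPart y = z := by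
  obtain ⟨m₁, n₁, h₁⟩ := exists_fractPart_eq x
  obtain ⟨m₂, n₂, h₂⟩ := exists_fractPart_eq y
  obtain ⟨m₃, n₃, h₃⟩ := exists_fractPart_eq (x + y)
  have hp : (p : ℚ) ≠ 0 := by exact_mod_cast (Fact.out : p.Prime).ne_zero
  refine exists_int_eq_of_norm_le_one (p := p)
    (m := m₃ * p ^ n₁ * p ^ n₂ - m₁ * p ^ n₂ * p ^ n₃ - m₂ * p ^ n₁ * p ^ n₃)
    (n := n₁ + n₂ + n₃) ?_ ?_
  · rw [h₁, h₂, h₃, pow_add, pow_add]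
    push_cast
    field_simp
  · have e : ((fractPart (x + y) - fractPart x - fractPart y : ℚ) : ℚ_[p]) =
        ((x - (fractPart x : ℚ_[p])) + (y - (fractPart y : ℚ_[p]))) +
          -(x + y - (fractPart (x + y) : ℚ_[p])) := by
      push_cast
      ring
    rw [e]
    refine (Padic.nonarchimedean _ _).trans (max_le ?_ ?_)
    · exact (Padic.nonarchimedean _ _).trans
        (max_le (norm_sub_fractPart_le x) (norm_sub_fractPart_le y))
    · rw [norm_neg]
      exact norm_sub_fractPart_le _

theorem chi_add (x y : ℚ_[p]) : chi (x + y) = chi x * chi y := by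
  obtain ⟨z, hz⟩ := exists_int_fractPart_add x y
  unfold chi
  rw [← Complex.exp_add, Complex.exp_eq_exp_iff_exists_int]
  refine ⟨z, ?_⟩
  have h : ((fractPart (x + y) : ℚ) : ℂ) = (fractPart x : ℚ) + (fractPart y : ℚ) + z := by
    have := congrArg (fun q : ℚ => (q : ℂ)) hz
    push_cast at this
    linear_combination this
  rw [h]
  ring

theorem chi_eq_one_iff (x : ℚ_[p]) : chi x = 1 ↔ ‖x‖ ≤ 1 := by
  have hx : x = (x - (fractPart x : ℚ_[p])) + (fractPart x : ℚ_[p]) := by ring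
  have key : chi x = 1 ↔ ∃ z : ℤ, fractPart x = z := by
    unfold chi
    rw [Complex.exp_eq_one_iff]
    refine exists_congr fun z => ?_
    have h2 : (2 * Real.pi * Complex.I : ℂ) ≠ 0 := Complex.two_pi_I_ne_zero
    rw [mul_comm (z : ℂ), mul_right_inj' h2]
    exact_mod_cast Iff.rfl
  rw [key]
  constructor
  · rintro ⟨z, hz⟩
    rw [hx]
    refine (Padic.nonarchimedean _ _).trans (max_le (norm_sub_fractPart_le x) ?_)
    rw [hz]
    simpa using Padic.norm_int_le_one z
  · intro h
    obtain ⟨m, n, hm⟩ := exists_fractPart_eq x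
    refine exists_int_eq_of_norm_le_one hm ?_
    have : (fractPart x : ℚ_[p]) = x + -(x - (fractPart x : ℚ_[p])) := by ring
    rw [this]
    refine (Padic.nonarchimedean _ _).trans (max_le h ?_)
    rw [norm_neg]
    exact norm_sub_fractPart_le x

theorem norm_chi (x : ℚ_[p]) : ‖chi x‖ = 1 := by
  unfold chi
  rw [Complex.norm_exp]
  simp

theorem continuous_chi : Continuous (chi : ℚ_[p] → ℂ) := by
  refine IsLocallyConstant.continuous ((IsLocallyConstant.iff_eventually_eq _).2 fun x => ?_)
  filter_upwards [Metric.closedBall_mem_nhds x one_pos] with y hy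
  rw [mem_closedBall_iff_norm] at hy
  have : y = (y - x) + x := by ring
  rw [this, chi_add, (chi_eq_one_iff _).2 hy, one_mul]

end Character

/-! ### The anisotropic form, its norm, and the duality between `f` and `f°`. -/

section QuadraticForm

variable {p : ℕ} [Fact p.Prime]

variable (p) in
theorem one_lt_cast_prime : (1 : ℝ) < p := by exact_mod_cast (Fact.out : p.Prime).one_lt

theorem norm_intCast_eq_one_of_not_isSquare {a : ℤ} (ha : ¬ IsSquare (a : ZMod p)) :
    ‖(a : ℚ_[p])‖ = 1 := by
  refine le_antisymm (Padic.norm_int_le_one a) (not_lt.1 fun h => ha ?_)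
  rw [Padic.norm_intCast_lt_one_iff] at h
  rw [(ZMod.intCast_zmod_eq_zero_iff_dvd a p).2 h]
  exact IsSquare.zero

/-- If the norm were less than `1`, the residue of `u` would be a square root of `a` modulo `p`. -/
theorem norm_sq_sub_intCast {a : ℤ} (ha : ¬ IsSquare (a : ZMod p)) {u : ℚ_[p]} (hu : ‖u‖ = 1) :
    ‖u ^ 2 - a‖ = 1 := by
  set v : ℤ_[p] := ⟨u, hu.le⟩ with hv
  have e : u ^ 2 - a = ((v ^ 2 - a : ℤ_[p]) : ℚ_[p]) := by
    rw [PadicInt.coe_sub, PadicInt.coe_pow, PadicInt.coe_intCast]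
  rw [e, ← PadicInt.norm_def]
  refine le_antisymm (PadicInt.norm_le_one _) (not_lt.1 fun h => ha ?_)
  rw [← PadicInt.mem_nonunits, ← IsLocalRing.mem_maximalIdeal, ← PadicInt.ker_toZMod,
    RingHom.mem_ker, map_sub, map_pow, map_intCast, sub_eq_zero] at h
  exact ⟨_, by rw [← h, sq]⟩

theorem norm_sq_sub_mul_sq {a : ℤ} (ha : ¬ IsSquare (a : ZMod p)) (y z : ℚ_[p]) :
    ‖y ^ 2 - a * z ^ 2‖ = max ‖y‖ ‖z‖ ^ 2 := by
  by_cases h : ‖y‖ = ‖z‖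
  · rw [h, max_self]
    by_cases hz : z = 0
    · have hy : y = 0 := by simpa [hz] using h
      simp [hy, hz]
    have e : y ^ 2 - a * z ^ 2 = ((y / z) ^ 2 - a) * z ^ 2 := by field_simp
    rw [e, norm_mul, norm_sq_sub_intCast ha, one_mul, norm_pow]
    rw [norm_div, h, div_self (norm_ne_zero_iff.2 hz)]
  · have e : ‖-(a * z ^ 2)‖ = ‖z‖ ^ 2 := by
      rw [norm_neg, norm_mul, norm_intCast_eq_one_of_not_isSquare ha, one_mul, norm_pow]
    have hne : ‖y ^ 2‖ ≠ ‖-(a * z ^ 2)‖ := by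
      rw [e, norm_pow]
      exact fun h' => h ((pow_left_inj₀ (norm_nonneg _) (norm_nonneg _) two_ne_zero).1 h')
    rw [sub_eq_add_neg, Padic.add_eq_max_of_ne hne, e, norm_pow]
    rcases le_total ‖y‖ ‖z‖ with hyz | hyz
    · rw [max_eq_right hyz, max_eq_right (pow_le_pow_left₀ (norm_nonneg _) hyz 2)]
    · rw [max_eq_left hyz, max_eq_left (pow_le_pow_left₀ (norm_nonneg _) hyz 2)]

theorem exists_norm_eq_zpow {x : ℚ_[p]} (hx : x ≠ 0) : ∃ n : ℤ, ‖x‖ = (p : ℝ) ^ n :=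
  ⟨_, Padic.norm_eq_zpow_neg_valuation hx⟩

/-- The two binary forms cannot cancel: nonzero values of the first have norm an even power of `p`,
those of `p` times the second an odd power. -/
theorem norm_form {a : ℤ} (ha : ¬ IsSquare (a : ZMod p)) (x : Space p) :
    ‖form a x‖ = max (max ‖x 0‖ ‖x 1‖ ^ 2) ((p : ℝ)⁻¹ * max ‖x 2‖ ‖x 3‖ ^ 2) := by
  have hp := one_lt_cast_prime p
  have hp0 : (p : ℝ) ≠ 0 := by positivity
  have e : form a x = (x 0 ^ 2 - a * x 1 ^ 2) + -(p * (x 2 ^ 2 - a * x 3 ^ 2)) := by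
    unfold form
    ring
  have e₁ := norm_sq_sub_mul_sq ha (x 0) (x 1)
  have e₂ : ‖-(p * (x 2 ^ 2 - a * x 3 ^ 2))‖ = (p : ℝ)⁻¹ * max ‖x 2‖ ‖x 3‖ ^ 2 := by
    rw [norm_neg, norm_mul, norm_sq_sub_mul_sq ha, Padic.norm_p]
  by_cases hne : max ‖x 0‖ ‖x 1‖ ^ 2 = (p : ℝ)⁻¹ * max ‖x 2‖ ‖x 3‖ ^ 2
  · have key : ∀ y z : ℚ_[p], max ‖y‖ ‖z‖ = 0 ∨ ∃ n : ℤ, max ‖y‖ ‖z‖ = (p : ℝ) ^ n := by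
      intro y z
      rcases max_choice ‖y‖ ‖z‖ with h | h <;> rw [h]
      · by_cases hy : y = 0
        · simp [hy]
        · exact Or.inr (exists_norm_eq_zpow hy)
      · by_cases hy : z = 0
        · simp [hy]
        · exact Or.inr (exists_norm_eq_zpow hy)
    rcases key (x 0) (x 1) with h₁ | ⟨m, hm⟩
    · have h₂ : (p : ℝ)⁻¹ * max ‖x 2‖ ‖x 3‖ ^ 2 = 0 := by rw [← hne, h₁]; simp
      have n₁ : x 0 ^ 2 - a * x 1 ^ 2 = 0 := norm_eq_zero.1 (by rw [e₁, h₁]; simp)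
      rw [e, n₁, zero_add, e₂, h₁, h₂]
      simp
    · rcases key (x 2) (x 3) with h₂ | ⟨n, hn⟩
      · rw [hm, h₂] at hne
        have : (p : ℝ) ^ m ≠ 0 := zpow_ne_zero _ hp0
        exact absurd (by simpa using hne) this
      · rw [hm, hn, ← zpow_natCast, ← zpow_natCast, ← zpow_mul, ← zpow_mul, ← zpow_neg_one,
          ← zpow_add₀ hp0] at hne
        have := zpow_right_injective₀ (by positivity) hp.ne' hne
        push_cast at this
        omega
  · rw [← e₁, ← e₂] at hne ⊢
    rw [e, Padic.add_eq_max_of_ne hne]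

variable (p) in
/-- The weights such that `‖form a x‖` is the maximum of `weight p i * ‖x i‖ ^ 2`. -/
def weight : Fin 4 → ℝ := ![1, 1, (p : ℝ)⁻¹, (p : ℝ)⁻¹]

theorem max_sq_le_iff {b c r : ℝ} (hb : 0 ≤ b) (hc : 0 ≤ c) :
    max b c ^ 2 ≤ r ↔ b ^ 2 ≤ r ∧ c ^ 2 ≤ r := by
  have : max b c ^ 2 = max (b ^ 2) (c ^ 2) := by
    rcases le_total b c with h | h
    · rw [max_eq_right h, max_eq_right (pow_le_pow_left₀ hb h 2)]
    · rw [max_eq_left h, max_eq_left (pow_le_pow_left₀ hc h 2)]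
  rw [this, max_le_iff]

/-- Sublevel sets of `|f|` are boxes, so questions about them can be settled one coordinate at a
time. -/
theorem norm_form_le_iff {a : ℤ} (ha : ¬ IsSquare (a : ZMod p)) (x : Space p) {r : ℝ} :
    ‖form a x‖ ≤ r ↔ ∀ i, weight p i * ‖x i‖ ^ 2 ≤ r := by
  have hp0 : (0 : ℝ) < p := one_pos.trans (one_lt_cast_prime p)
  rw [norm_form ha, max_le_iff, inv_mul_le_iff₀ hp0, max_sq_le_iff (norm_nonneg _) (norm_nonneg _),
    max_sq_le_iff (norm_nonneg _) (norm_nonneg _), ← inv_mul_le_iff₀ hp0, ← inv_mul_le_iff₀ hp0]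
  simp [Fin.forall_fin_succ, weight, and_assoc]

theorem dualForm_eq_form_rev (a : ℤ) (ξ : Space p) :
    dualForm a ξ = form a (fun i => ξ i.rev) := by
  have h0 : (0 : Fin 4).rev = 3 := rfl
  have h1 : (1 : Fin 4).rev = 2 := rfl
  have h2 : (2 : Fin 4).rev = 1 := rfl
  have h3 : (3 : Fin 4).rev = 0 := rfl
  simp only [dualForm, form, h0, h1, h2, h3]
  ring

theorem norm_dualForm_le_iff {a : ℤ} (ha : ¬ IsSquare (a : ZMod p)) (ξ : Space p) {r : ℝ} :
    ‖dualForm a ξ‖ ≤ r ↔ ∀ i : Fin 4, weight p i.rev * ‖ξ i‖ ^ 2 ≤ r := by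
  rw [dualForm_eq_form_rev, norm_form_le_iff ha]
  exact ⟨fun h i => by simpa using h i.rev, fun h i => by simpa using h i.rev⟩

theorem weight_pos (i : Fin 4) : 0 < weight p i := by
  have hp0 : (0 : ℝ) < p := one_pos.trans (one_lt_cast_prime p)
  fin_cases i <;> simp [weight, hp0]

theorem weight_le_one (i : Fin 4) : weight p i ≤ 1 := by
  have hp := inv_le_one_of_one_le₀ (one_lt_cast_prime p).le
  fin_cases i <;> simp [weight, hp]

theorem inv_le_weight (i : Fin 4) : (p : ℝ)⁻¹ ≤ weight p i := by
  have hp := inv_le_one_of_one_le₀ (one_lt_cast_prime p).le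
  fin_cases i <;> simp [weight, hp]

/-- `weight p i.rev` is the weight of `f°` on the coordinate `i`. That the product is the same for
all `i` is what makes the boxes of `f` and `f°` dual. -/
theorem weight_mul_weight_rev {p : ℕ} (i : Fin 4) : weight p i * weight p i.rev = (p : ℝ)⁻¹ := by
  fin_cases i <;> simp [weight, Fin.rev]

theorem norm_form_add_le {a : ℤ} (ha : ¬ IsSquare (a : ZMod p)) (x y : Space p) :
    ‖form a (x + y)‖ ≤ max ‖form a x‖ ‖form a y‖ := by
  rw [norm_form_le_iff ha]
  intro i
  rcases max_choice ‖x i‖ ‖y i‖ with h | h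
  · refine le_trans ?_ (((norm_form_le_iff ha x).1 le_rfl i).trans (le_max_left _ _))
    exact mul_le_mul_of_nonneg_left (pow_le_pow_left₀ (norm_nonneg _)
      ((Padic.nonarchimedean _ _).trans h.le) 2) (weight_pos i).le
  · refine le_trans ?_ (((norm_form_le_iff ha y).1 le_rfl i).trans (le_max_right _ _))
    exact mul_le_mul_of_nonneg_left (pow_le_pow_left₀ (norm_nonneg _)
      ((Padic.nonarchimedean _ _).trans h.le) 2) (weight_pos i).le

theorem form_neg (a : ℤ) (x : Space p) : form a (-x) = form a x := by
  simp [form]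

theorem norm_form_le_norm_sq {a : ℤ} (ha : ¬ IsSquare (a : ZMod p)) (x : Space p) :
    ‖form a x‖ ≤ ‖x‖ ^ 2 := by
  rw [norm_form_le_iff ha]
  intro i
  calc weight p i * ‖x i‖ ^ 2 ≤ 1 * ‖x‖ ^ 2 :=
        mul_le_mul (weight_le_one i) (pow_le_pow_left₀ (norm_nonneg _) (norm_le_pi_norm x i) 2)
          (by positivity) zero_le_one
    _ = ‖x‖ ^ 2 := one_mul _

theorem inv_mul_norm_sq_le_norm_form {a : ℤ} (ha : ¬ IsSquare (a : ZMod p)) (x : Space p) :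
    (p : ℝ)⁻¹ * ‖x‖ ^ 2 ≤ ‖form a x‖ := by
  obtain ⟨i, hi⟩ := Finite.exists_max (fun i => ‖x i‖)
  have hi' : ‖x‖ ≤ ‖x i‖ := (pi_norm_le_iff_of_nonneg (norm_nonneg _)).2 hi
  exact (mul_le_mul (inv_le_weight i) (pow_le_pow_left₀ (norm_nonneg _) hi' 2) (by positivity)
    (weight_pos i).le).trans ((norm_form_le_iff ha x).1 le_rfl i)

theorem norm_form_pos {a : ℤ} (ha : ¬ IsSquare (a : ZMod p)) {x : Space p} (hx : x ≠ 0) :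
    0 < ‖form a x‖ := by
  have hp0 : (0 : ℝ) < p := one_pos.trans (one_lt_cast_prime p)
  have := norm_pos_iff.2 hx
  exact lt_of_lt_of_le (by positivity) (inv_mul_norm_sq_le_norm_form ha x)

/-- The two-sided comparison with `‖·‖²` gives `|f(ξ)| ≤ ‖ξ‖² < p⁻²‖x‖² ≤ |f(x)|`, and the
ultrametric inequality does the rest. -/
theorem norm_form_add_eq {a : ℤ} (ha : ¬ IsSquare (a : ZMod p)) {x ξ : Space p}
    (h : ‖ξ‖ < (p : ℝ)⁻¹ * ‖x‖) : ‖form a (x + ξ)‖ = ‖form a x‖ := by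
  have hp := one_lt_cast_prime p
  have hpi : (p : ℝ)⁻¹ ≤ 1 := inv_le_one_of_one_le₀ hp.le
  have hpi0 : 0 < (p : ℝ)⁻¹ := by positivity
  have hlt : ‖form a ξ‖ < ‖form a x‖ := by
    calc ‖form a ξ‖ ≤ ‖ξ‖ ^ 2 := norm_form_le_norm_sq ha ξ
      _ < ((p : ℝ)⁻¹ * ‖x‖) ^ 2 := pow_lt_pow_left₀ h (norm_nonneg _) two_ne_zero
      _ = (p : ℝ)⁻¹ * ((p : ℝ)⁻¹ * ‖x‖ ^ 2) := by ring
      _ ≤ 1 * ((p : ℝ)⁻¹ * ‖x‖ ^ 2) := mul_le_mul_of_nonneg_right hpi (by positivity)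
      _ ≤ ‖form a x‖ := by rw [one_mul]; exact inv_mul_norm_sq_le_norm_form ha x
  refine le_antisymm ((norm_form_add_le ha x ξ).trans (max_le le_rfl hlt.le)) ?_
  have := norm_form_add_le ha (x + ξ) (-ξ)
  rw [add_neg_cancel_right, form_neg] at this
  exact (le_max_iff.1 this).resolve_right (not_le.2 hlt)

theorem norm_le_one_of_lt_prime {y : ℚ_[p]} (h : ‖y‖ < p) : ‖y‖ ≤ 1 := by
  have := (Padic.norm_le_pow_iff_norm_lt_pow_add_one y 0).2 (by simpa using h)
  simpa using this

/-- Multiplying the two box conditions gives `p⁻¹|ξ_i x_i|² ≤ 1`, so `|ξ_i x_i| ≤ √p < p`. As norms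
are powers of `p`, this forces `|ξ_i x_i| ≤ 1`. -/
theorem norm_pairing_le_one {a : ℤ} (ha : ¬ IsSquare (a : ZMod p)) {x ξ : Space p} {n : ℤ}
    (hx : ‖form a x‖ ≤ (p : ℝ) ^ (-n)) (hξ : ‖dualForm a ξ‖ ≤ (p : ℝ) ^ n) :
    ‖∑ i, ξ i * x i‖ ≤ 1 := by
  have hp := one_lt_cast_prime p
  have hp0 : (0 : ℝ) < p := by positivity
  refine IsUltrametricDist.norm_sum_le_of_forall_le_of_nonneg zero_le_one fun i _ =>
    norm_le_one_of_lt_prime ?_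
  have h₁ := (norm_form_le_iff ha x).1 hx i
  have h₂ := (norm_dualForm_le_iff ha ξ).1 hξ i
  have h₃ := mul_le_mul h₁ h₂ (by have := weight_pos (p := p) i.rev; positivity) (by positivity)
  have h₄ : weight p i * ‖x i‖ ^ 2 * (weight p i.rev * ‖ξ i‖ ^ 2) =
      (p : ℝ)⁻¹ * ‖ξ i * x i‖ ^ 2 := by
    rw [← weight_mul_weight_rev i, norm_mul]
    ring
  rw [h₄, ← zpow_add₀ hp0.ne', neg_add_cancel, zpow_zero, inv_mul_le_iff₀ hp0, mul_one] at h₃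
  refine lt_of_pow_lt_pow_left₀ 2 hp0.le (h₃.trans_lt ?_)
  nlinarith

theorem exists_one_lt_norm_pairing {a : ℤ} (ha : ¬ IsSquare (a : ZMod p)) {x : Space p} {n : ℤ}
    (hx : ¬ ‖form a x‖ ≤ (p : ℝ) ^ (-n)) :
    ∃ ξ : Space p, ‖dualForm a ξ‖ ≤ (p : ℝ) ^ n ∧ 1 < ‖∑ i, ξ i * x i‖ := by
  have hp := one_lt_cast_prime p
  have hp0 : (0 : ℝ) < p := by positivity
  have hpp : (p : ℚ_[p]) ≠ 0 := by exact_mod_cast (Fact.out : p.Prime).ne_zero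
  rw [norm_form_le_iff ha] at hx
  push Not at hx
  obtain ⟨i, hi⟩ := hx
  have hxi : x i ≠ 0 := by
    intro h
    rw [h, norm_zero, zero_pow two_ne_zero, mul_zero] at hi
    exact hi.not_gt (by positivity)
  have hw := weight_pos (p := p) i
  have hxn := norm_pos_iff.2 hxi
  -- Writing the weighted square as `p ^ m` turns the strict inequality `p ^ (-n) < p ^ m` into `1 -
  -- m ≤ n`, a gain of a full factor `p`.
  obtain ⟨m, hm⟩ : ∃ m : ℤ, weight p i * ‖x i‖ ^ 2 = (p : ℝ) ^ m := by
    have hw : ∃ l : ℤ, weight p i = (p : ℝ) ^ l := by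
      fin_cases i
      · exact ⟨0, by simp [weight]⟩
      · exact ⟨0, by simp [weight]⟩
      · exact ⟨-1, by simp [weight]⟩
      · exact ⟨-1, by simp [weight]⟩
    obtain ⟨l, hl⟩ := hw
    obtain ⟨k, hk⟩ := exists_norm_eq_zpow hxi
    refine ⟨l + k * 2, ?_⟩
    rw [hl, hk, zpow_add₀ hp0.ne', zpow_mul]
    norm_cast
  -- This vector pairs with `x` to `p⁻¹`, just outside `ℤ_p`, and its only nonzero weighted square
  -- is `p ^ (1 - m)`.
  refine ⟨Pi.single i (x i * p)⁻¹, ?_, ?_⟩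
  · rw [norm_dualForm_le_iff ha]
    intro j
    by_cases hj : j = i
    · subst hj
      rw [hm] at hi
      have hmn := (zpow_lt_zpow_iff_right₀ hp).1 hi
      have hw' : weight p j.rev = (p : ℝ)⁻¹ / weight p j := by
        rw [← weight_mul_weight_rev j]
        field_simp
      rw [Pi.single_eq_same, norm_inv, norm_mul, Padic.norm_p, hw']
      have e : (p : ℝ)⁻¹ / weight p j * (‖x j‖ * (p : ℝ)⁻¹)⁻¹ ^ 2 =
          p * (weight p j * ‖x j‖ ^ 2)⁻¹ := by
        field_simp
      rw [e, hm, ← zpow_neg, ← zpow_one_add₀ hp0.ne']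
      exact zpow_le_zpow_right₀ hp.le (by omega)
    · rw [Pi.single_eq_of_ne hj]
      simp only [norm_zero]
      have : 0 < (p : ℝ) ^ n := by positivity
      simpa using this.le
  · rw [Finset.sum_eq_single i (fun j _ hj => by rw [Pi.single_eq_of_ne hj, zero_mul])
      (fun h => absurd (Finset.mem_univ i) h), Pi.single_eq_same]
    have : (x i * (p : ℚ_[p]))⁻¹ * x i = (p : ℚ_[p])⁻¹ := by field_simp
    rw [this, norm_inv, Padic.norm_p, inv_inv]
    exact hp

end QuadraticForm

/-! ### The lattices `L_n`, their volumes, and the Fourier transforms of their indicators. -/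

section Lattice

variable {p : ℕ} [Fact p.Prime]

theorem continuous_dualForm (a : ℤ) : Continuous (dualForm a : Space p → ℚ_[p]) := by
  unfold dualForm
  fun_prop

theorem norm_dualForm_add_le {a : ℤ} (ha : ¬ IsSquare (a : ZMod p)) (ξ η : Space p) :
    ‖dualForm a (ξ + η)‖ ≤ max ‖dualForm a ξ‖ ‖dualForm a η‖ := by
  simp only [dualForm_eq_form_rev]
  exact norm_form_add_le ha (fun i : Fin 4 => ξ i.rev) (fun i => η i.rev)

/-- The lattice of all `ξ` with `|f°(ξ)| ≤ p ^ n`. -/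
def dualBall {a : ℤ} (ha : ¬ IsSquare (a : ZMod p)) (n : ℤ) : AddSubgroup (Space p) where
  carrier := {ξ | ‖dualForm a ξ‖ ≤ (p : ℝ) ^ n}
  zero_mem' := by
    have : 0 ≤ (p : ℝ) ^ n := by positivity
    simpa [dualForm] using this
  add_mem' := fun hξ hη => (norm_dualForm_add_le ha _ _).trans (max_le hξ hη)
  neg_mem' := fun {ξ} hξ => by simpa [dualForm] using hξ

variable {a : ℤ} (ha : ¬ IsSquare (a : ZMod p))

theorem mem_dualBall {n : ℤ} {ξ : Space p} :
    ξ ∈ dualBall ha n ↔ ‖dualForm a ξ‖ ≤ (p : ℝ) ^ n := Iff.rfl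

theorem isClosed_dualBall (n : ℤ) : IsClosed (dualBall ha n : Set (Space p)) :=
  isClosed_le (continuous_dualForm a).norm continuous_const

theorem measurableSet_dualBall (n : ℤ) : MeasurableSet (dualBall ha n : Set (Space p)) :=
  (isClosed_dualBall ha n).measurableSet

theorem inv_mul_norm_sq_le_one_iff {y : ℚ_[p]} : (p : ℝ)⁻¹ * ‖y‖ ^ 2 ≤ 1 ↔ ‖y‖ ≤ 1 := by
  have hp := one_lt_cast_prime p
  have hp0 : (0 : ℝ) < p := by positivity
  rw [inv_mul_le_iff₀ hp0, mul_one]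
  constructor
  · intro h
    refine norm_le_one_of_lt_prime (lt_of_pow_lt_pow_left₀ 2 hp0.le (h.trans_lt ?_))
    nlinarith
  · intro h
    nlinarith [norm_nonneg y]

theorem norm_sq_le_inv_iff {y : ℚ_[p]} : ‖y‖ ^ 2 ≤ (p : ℝ)⁻¹ ↔ ‖y‖ < 1 := by
  have hp := one_lt_cast_prime p
  have hpi : (p : ℝ)⁻¹ < 1 := inv_lt_one_of_one_lt₀ hp
  have hpi0 : 0 < (p : ℝ)⁻¹ := by positivity
  constructor
  · intro h
    exact lt_of_pow_lt_pow_left₀ 2 zero_le_one (by rw [one_pow]; exact h.trans_lt hpi)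
  · intro h
    have := (Padic.norm_le_pow_iff_norm_lt_pow_add_one y (-1)).2 (by simpa using h)
    rw [zpow_neg_one] at this
    nlinarith [norm_nonneg y]

theorem mem_dualBall_zero {ξ : Space p} : ξ ∈ dualBall ha 0 ↔ ‖ξ‖ ≤ 1 := by
  have h0 : (0 : Fin 4).rev = 3 := rfl
  have h1 : (1 : Fin 4).rev = 2 := rfl
  have h2 : (2 : Fin 4).rev = 1 := rfl
  have h3 : (3 : Fin 4).rev = 0 := rfl
  rw [mem_dualBall, norm_dualForm_le_iff ha, pi_norm_le_iff_of_nonneg zero_le_one, zpow_zero]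
  refine forall_congr' fun i => ?_
  have : ∀ y : ℚ_[p], ‖y‖ ^ 2 ≤ 1 ↔ ‖y‖ ≤ 1 := fun y => pow_le_one_iff_of_nonneg (norm_nonneg _)
    two_ne_zero
  fin_cases i <;> simp [weight, h0, h1, h2, h3, inv_mul_norm_sq_le_one_iff, this]

theorem mem_dualBall_neg_one {ξ : Space p} : ξ ∈ dualBall ha (-1) ↔
    (‖ξ 0‖ ≤ 1 ∧ ‖ξ 1‖ ≤ 1) ∧ ‖ξ 2‖ < 1 ∧ ‖ξ 3‖ < 1 := by
  have hp0 : (0 : ℝ) < p := one_pos.trans (one_lt_cast_prime p)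
  have h0 : (0 : Fin 4).rev = 3 := rfl
  have h1 : (1 : Fin 4).rev = 2 := rfl
  have h2 : (2 : Fin 4).rev = 1 := rfl
  have h3 : (3 : Fin 4).rev = 0 := rfl
  have h : ∀ y : ℚ_[p], ‖y‖ ^ 2 ≤ 1 ↔ ‖y‖ ≤ 1 := fun y => pow_le_one_iff_of_nonneg (norm_nonneg _)
    two_ne_zero
  rw [mem_dualBall, norm_dualForm_le_iff ha, zpow_neg_one]
  simp [Fin.forall_fin_succ, weight, h0, h1, h2, h3, norm_sq_le_inv_iff, hp0, h, and_assoc]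

instance : (haar p).IsAddHaarMeasure := by unfold haar; infer_instance

theorem coe_dualBall_zero : (dualBall ha 0 : Set (Space p)) = unitBall p := by
  ext ξ
  rw [SetLike.mem_coe, mem_dualBall_zero ha]
  exact mem_closedBall_zero_iff.symm

theorem haar_dualBall_zero : haar p (dualBall ha 0) = 1 := by
  rw [coe_dualBall_zero]
  exact Measure.addHaarMeasure_self

/-- The vector `(0, 0, i, j)`. -/
def residueVector (c : Fin p × Fin p) : Space p :=
  ![0, 0, ((c.1 : ℕ) : ℚ_[p]), ((c.2 : ℕ) : ℚ_[p])]

theorem exists_norm_sub_natCast_lt_one {y : ℚ_[p]} (hy : ‖y‖ ≤ 1) :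
    ∃ i : Fin p, ‖y - ((i : ℕ) : ℚ_[p])‖ < 1 := by
  set z : ℤ_[p] := ⟨y, hy⟩
  obtain ⟨n, hn, h⟩ := PadicInt.exists_mem_range z
  refine ⟨⟨n, hn⟩, ?_⟩
  rw [IsLocalRing.mem_maximalIdeal, PadicInt.mem_nonunits, PadicInt.norm_def, PadicInt.coe_sub,
    PadicInt.coe_natCast] at h
  exact h

theorem eq_of_norm_sub_lt_one {y : ℚ_[p]} {i j : Fin p} (hi : ‖y - ((i : ℕ) : ℚ_[p])‖ < 1)
    (hj : ‖y - ((j : ℕ) : ℚ_[p])‖ < 1) : i = j := by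
  have h : ‖(((i : ℕ) - (j : ℕ) : ℤ) : ℚ_[p])‖ < 1 := by
    have e : (((i : ℕ) - (j : ℕ) : ℤ) : ℚ_[p]) =
        (y - ((j : ℕ) : ℚ_[p])) + -(y - ((i : ℕ) : ℚ_[p])) := by
      push_cast
      ring
    rw [e]
    exact (Padic.nonarchimedean _ _).trans_lt (max_lt hj (by rwa [norm_neg]))
  rw [Padic.norm_intCast_lt_one_iff] at h
  have := Int.eq_zero_of_abs_lt_dvd h (by rw [abs_lt]; omega)
  exact Fin.ext (by omega)

theorem mem_add_dualBall_neg_one {c : Fin p × Fin p} {ξ : Space p} :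
    -residueVector c + ξ ∈ dualBall ha (-1) ↔ (‖ξ 0‖ ≤ 1 ∧ ‖ξ 1‖ ≤ 1) ∧
      ‖ξ 2 - ((c.1 : ℕ) : ℚ_[p])‖ < 1 ∧ ‖ξ 3 - ((c.2 : ℕ) : ℚ_[p])‖ < 1 := by
  rw [mem_dualBall_neg_one]
  simp [residueVector, neg_add_eq_sub]

/-- `L_{-1}` is cut out of `ℤ_p⁴` by the vanishing modulo `p` of the last two coordinates, so their
residues label `p²` cosets. -/
theorem dualBall_zero_eq_iUnion : (dualBall ha 0 : Set (Space p)) =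
    ⋃ c : Fin p × Fin p, (fun ξ => -residueVector c + ξ) ⁻¹' (dualBall ha (-1)) := by
  ext ξ
  simp only [Set.mem_iUnion, Set.mem_preimage, SetLike.mem_coe, mem_add_dualBall_neg_one]
  rw [mem_dualBall_zero, pi_norm_le_iff_of_nonneg zero_le_one]
  constructor
  · intro h
    obtain ⟨i, hi⟩ := exists_norm_sub_natCast_lt_one (h 2)
    obtain ⟨j, hj⟩ := exists_norm_sub_natCast_lt_one (h 3)
    exact ⟨(i, j), ⟨h 0, h 1⟩, hi, hj⟩
  · rintro ⟨⟨i, j⟩, ⟨h0, h1⟩, hi, hj⟩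
    have key : ∀ (y : ℚ_[p]) (i : ℕ), ‖y - (i : ℚ_[p])‖ < 1 → ‖y‖ ≤ 1 := by
      intro y i h
      have e : y = (y - (i : ℚ_[p])) + ((i : ℤ) : ℚ_[p]) := by push_cast; ring
      rw [e]
      exact (Padic.nonarchimedean _ _).trans (max_le h.le (Padic.norm_int_le_one _))
    have h2 := key _ _ hi
    have h3 := key _ _ hj
    intro k
    fin_cases k
    exacts [h0, h1, h2, h3]

theorem haar_dualBall_neg_one : (p : ENNReal) ^ 2 * haar p (dualBall ha (-1)) = 1 := by
  rw [← haar_dualBall_zero ha, dualBall_zero_eq_iUnion, measure_iUnion]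
  · simp only [measure_preimage_add]
    rw [tsum_fintype]
    simp [sq]
  · intro c d hcd
    refine Set.disjoint_left.2 fun ξ hc hd => hcd ?_
    rw [Set.mem_preimage, SetLike.mem_coe, mem_add_dualBall_neg_one] at hc hd
    exact Prod.ext (eq_of_norm_sub_lt_one hc.2.1 hd.2.1) (eq_of_norm_sub_lt_one hc.2.2 hd.2.2)
  · exact fun c => (measurable_const_add _) (measurableSet_dualBall ha (-1))

variable (p) in
/-- The similitude `(ξ₁, ξ₂, ξ₃, ξ₄) ↦ (ξ₃, ξ₄, p ξ₁, p ξ₂)`, which divides `|f°|` by `p`. -/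
def similitude : Space p ≃+ Space p where
  toFun ξ := ![ξ 2, ξ 3, p * ξ 0, p * ξ 1]
  invFun ξ := ![(p : ℚ_[p])⁻¹ * ξ 2, (p : ℚ_[p])⁻¹ * ξ 3, ξ 0, ξ 1]
  left_inv ξ := by
    have hpp : (p : ℚ_[p]) ≠ 0 := by exact_mod_cast (Fact.out : p.Prime).ne_zero
    ext i
    fin_cases i <;> simp [hpp]
  right_inv ξ := by
    have hpp : (p : ℚ_[p]) ≠ 0 := by exact_mod_cast (Fact.out : p.Prime).ne_zero
    ext i
    fin_cases i <;> simp [hpp]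
  map_add' ξ η := by
    ext i
    fin_cases i <;> simp [mul_add]

theorem continuous_similitude : Continuous (similitude p) := by
  refine continuous_pi fun i => ?_
  fin_cases i <;> simp [similitude] <;> fun_prop

theorem continuous_similitude_symm : Continuous (similitude p).symm := by
  refine continuous_pi fun i => ?_
  fin_cases i <;> simp [similitude] <;> fun_prop

theorem norm_dualForm_similitude {a : ℤ} (ha : ¬ IsSquare (a : ZMod p)) (ξ : Space p) :
    ‖dualForm a (similitude p ξ)‖ = (p : ℝ)⁻¹ * ‖dualForm a ξ‖ := by
  have hpi : 0 ≤ (p : ℝ)⁻¹ := by positivity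
  have h0 : (0 : Fin 4).rev = 3 := rfl
  have h1 : (1 : Fin 4).rev = 2 := rfl
  have h2 : (2 : Fin 4).rev = 1 := rfl
  have h3 : (3 : Fin 4).rev = 0 := rfl
  rw [dualForm_eq_form_rev, dualForm_eq_form_rev, norm_form ha, norm_form ha]
  simp only [h0, h1, h2, h3]
  have e : max ‖similitude p ξ 3‖ ‖similitude p ξ 2‖ = (p : ℝ)⁻¹ * max ‖ξ 1‖ ‖ξ 0‖ := by
    simp [similitude, mul_max_of_nonneg _ _ hpi]
  have e' : max ‖similitude p ξ 1‖ ‖similitude p ξ 0‖ = max ‖ξ 3‖ ‖ξ 2‖ := by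
    simp [similitude]
  rw [e, e', mul_max_of_nonneg (max ‖ξ 3‖ ‖ξ 2‖ ^ 2) _ hpi, max_comm]
  congr 1
  ring

theorem similitude_preimage_dualBall (n : ℤ) :
    similitude p ⁻¹' (dualBall ha n) = (dualBall ha (n + 1) : Set (Space p)) := by
  have hp0 : (0 : ℝ) < p := one_pos.trans (one_lt_cast_prime p)
  ext ξ
  rw [Set.mem_preimage, SetLike.mem_coe, SetLike.mem_coe, mem_dualBall, mem_dualBall,
    norm_dualForm_similitude ha, inv_mul_le_iff₀ hp0, add_comm, zpow_one_add₀ hp0.ne']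

/-- The similitude pulls `L_n` back to `L_{n+1}`. It pushes Haar measure to a multiple of itself,
and evaluation on `L_0 = ℤ_p⁴` shows the factor to be the volume of `L_1`. -/
theorem haar_dualBall_add_one (n : ℤ) :
    haar p (dualBall ha (n + 1)) = haar p (dualBall ha 1) * haar p (dualBall ha n) := by
  have : (Measure.map (similitude p) (haar p)).IsAddHaarMeasure :=
    AddEquiv.isAddHaarMeasure_map _ (similitude p) continuous_similitude continuous_similitude_symm
  have key : ∀ m : ℤ, Measure.map (similitude p) (haar p) (dualBall ha m) =
      haar p (dualBall ha (m + 1)) := fun m => by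
    rw [Measure.map_apply continuous_similitude.measurable (measurableSet_dualBall ha m),
      similitude_preimage_dualBall]
  have hu := Measure.addHaarMeasure_unique (Measure.map (similitude p) (haar p)) (unitBall p)
  have hc : Measure.map (similitude p) (haar p) (unitBall p) = haar p (dualBall ha 1) := by
    rw [← coe_dualBall_zero ha, key, zero_add]
  rw [hc] at hu
  rw [← key, hu, Measure.smul_apply, smul_eq_mul]
  rfl

theorem haar_dualBall_one : haar p (dualBall ha 1) = (p : ENNReal) ^ 2 := by
  have h := haar_dualBall_add_one ha (-1)
  rw [neg_add_cancel, haar_dualBall_zero] at h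
  have h' := haar_dualBall_neg_one ha
  rw [← mul_one ((p : ENNReal) ^ 2), h, mul_left_comm, h', mul_one]

theorem haar_dualBall (n : ℤ) : haar p (dualBall ha n) = ENNReal.ofReal ((p : ℝ) ^ (2 * n)) := by
  have hp0 : (0 : ℝ) < p := one_pos.trans (one_lt_cast_prime p)
  have hc : haar p (dualBall ha 1) = ENNReal.ofReal ((p : ℝ) ^ 2) := by
    rw [haar_dualBall_one, ENNReal.ofReal_pow hp0.le, ENNReal.ofReal_natCast]
  have step : ∀ n : ℤ, haar p (dualBall ha n) = ENNReal.ofReal ((p : ℝ) ^ (2 * n)) ↔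
      haar p (dualBall ha (n + 1)) = ENNReal.ofReal ((p : ℝ) ^ (2 * (n + 1))) := by
    intro n
    have e : (p : ℝ) ^ (2 * (n + 1)) = (p : ℝ) ^ 2 * (p : ℝ) ^ (2 * n) := by
      rw [mul_add, mul_one, add_comm, zpow_add₀ hp0.ne']
      rfl
    rw [haar_dualBall_add_one, hc, e, ENNReal.ofReal_mul (by positivity), ENNReal.mul_right_inj
      (by simp [(Fact.out : p.Prime).ne_zero]) ENNReal.ofReal_ne_top]
  induction n using Int.induction_on with
  | zero => simp [haar_dualBall_zero]
  | succ n ih => exact (step _).1 ih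
  | pred n ih => exact (step _).2 (by rwa [sub_add_cancel])

theorem continuous_chi_pairing (x : Space p) : Continuous fun ξ : Space p => chi (∑ i, ξ i * x i) :=
  continuous_chi.comp (by fun_prop)

theorem setIntegral_chi (x : Space p) (n : ℤ) :
    ∫ ξ in (dualBall ha n : Set (Space p)), chi (∑ i, ξ i * x i) ∂(haar p) =
      if ‖form a x‖ ≤ (p : ℝ) ^ (-n) then (((p : ℝ) ^ (2 * n) : ℝ) : ℂ) else 0 := by
  split_ifs with h
  · have : ∫ ξ in (dualBall ha n : Set (Space p)), chi (∑ i, ξ i * x i) ∂(haar p) =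
        ∫ ξ in (dualBall ha n : Set (Space p)), (1 : ℂ) ∂(haar p) :=
      setIntegral_congr_fun (measurableSet_dualBall ha n) fun ξ hξ =>
        (chi_eq_one_iff _).2 (norm_pairing_le_one ha h hξ)
    rw [this, setIntegral_const, measureReal_def, haar_dualBall, ENNReal.toReal_ofReal
      (by positivity)]
    simp
  · obtain ⟨ξ₀, h₁, h₂⟩ := exists_one_lt_norm_pairing ha h
    have hne : chi (∑ i, ξ₀ i * x i) ≠ 1 := fun hc => not_le.2 h₂ ((chi_eq_one_iff _).1 hc)
    rw [← integral_indicator (measurableSet_dualBall ha n)]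
    set F := (dualBall ha n : Set (Space p)).indicator fun ξ => chi (∑ i, ξ i * x i) with hF
    -- Orthogonality: translation by `ξ₀` preserves the lattice and multiplies the integrand by
    -- `χ(ξ₀ · x) ≠ 1`, so by invariance of Haar measure the integral vanishes.
    have hshift : ∀ ξ, F (ξ + ξ₀) = F ξ * chi (∑ i, ξ₀ i * x i) := by
      intro ξ
      by_cases hξ : ξ ∈ dualBall ha n
      · rw [hF, Set.indicator_of_mem (show ξ ∈ (dualBall ha n : Set (Space p)) from hξ),
          Set.indicator_of_mem (show ξ + ξ₀ ∈ (dualBall ha n : Set (Space p)) from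
            add_mem hξ h₁), ← chi_add, ← Finset.sum_add_distrib]
        simp only [Pi.add_apply, add_mul]
      · rw [hF, Set.indicator_of_notMem (show ξ ∉ (dualBall ha n : Set (Space p)) from hξ),
          Set.indicator_of_notMem (show ξ + ξ₀ ∉ (dualBall ha n : Set (Space p)) from
            fun h' => hξ ((AddSubgroup.add_mem_cancel_right _ h₁).1 h')), zero_mul]
    have hint := integral_add_right_eq_self (μ := haar p) F ξ₀
    simp only [hshift] at hint
    rw [integral_mul_const] at hint
    have : (∫ ξ, F ξ ∂(haar p)) * (chi (∑ i, ξ₀ i * x i) - 1) = 0 := by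
      rw [mul_sub, hint, mul_one, sub_self]
    exact (mul_eq_zero.1 this).resolve_right (sub_ne_zero.2 hne)

end Lattice

/-! ### Real series built from the jumps. -/

/-- The jump of the decreasing function `r ↦ exp (-s r ^ α)` between `r = b ^ n` and
`r = b ^ (n + 1)`. -/
def heatJump (b α s : ℝ) (n : ℤ) : ℝ :=
  Real.exp (-s * (b ^ n) ^ α) - Real.exp (-s * (b ^ (n + 1)) ^ α)

/-- The constant term is dropped because it cancels in each jump; this is why the series in (ii)
starts at order `1`. -/
theorem hasSum_exp_sub_one (x : ℝ) : HasSum (fun m : ℕ => x ^ (m + 1) / (m + 1).factorial)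
    (Real.exp x - 1) := by
  have h := NormedSpace.expSeries_div_hasSum_exp x
  rw [← Real.exp_eq_exp_ℝ] at h
  simpa using (hasSum_nat_add_iff' 1).2 h

section Jump

variable {b α s : ℝ}

theorem heatJump_nonneg (hb : 1 < b) (hα : 0 < α) (hs : 0 < s) (n : ℤ) :
    0 ≤ heatJump b α s n := by
  refine sub_nonneg.2 (Real.exp_le_exp.2 ?_)
  have hb0 : 0 < b := one_pos.trans hb
  have := Real.rpow_le_rpow (by positivity) (zpow_le_zpow_right₀ hb.le (by omega : n ≤ n + 1)) hα.le
  nlinarith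

theorem exp_le_inv_pow (hb : 1 < b) (hα : 0 < α) (hs : 0 < s) : ∃ C : ℝ, ∀ n : ℕ,
    Real.exp (-s * (b ^ n) ^ α) * b ^ (2 * n) ≤ C * (b⁻¹) ^ n := by
  have hb0 : 0 < b := one_pos.trans hb
  -- In the bound `(s y) ^ k / k! ≤ exp (s y)`, the choice `kα ≥ 3` absorbs the volume factor `b ^
  -- (2n)` and leaves one power of `b ^ n` for geometric decay.
  obtain ⟨k, hk⟩ := exists_nat_ge (3 / α)
  rw [div_le_iff₀ hα] at hk
  refine ⟨k.factorial / s ^ k, fun n => ?_⟩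
  set y := (b ^ n) ^ α with hy
  have hy0 : 0 < y := by positivity
  have h₁ := Real.pow_div_factorial_le_exp (s * y) (by positivity) k
  have h₂ : (b ^ n) ^ 3 ≤ y ^ k := by
    rw [hy, ← Real.rpow_mul_natCast (by positivity), ← Real.rpow_natCast (b ^ n) 3]
    refine Real.rpow_le_rpow_of_exponent_le (one_le_pow₀ hb.le) ?_
    push_cast
    linarith
  have h₃ : s ^ k * (b ^ n) ^ 3 ≤ k.factorial * Real.exp (s * y) := by
    rw [div_le_iff₀ (by positivity), mul_pow] at h₁
    have := mul_le_mul_of_nonneg_left h₂ (pow_nonneg hs.le k)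
    linarith
  rw [neg_mul, Real.exp_neg, inv_pow, pow_mul', ← div_eq_mul_inv, div_div, inv_mul_eq_div,
    div_le_div_iff₀ (by positivity) (by positivity)]
  calc (b ^ n) ^ 2 * (s ^ k * b ^ n) = s ^ k * (b ^ n) ^ 3 := by ring
    _ ≤ _ := h₃

/-- As `n → ∞` the exponential beats the volume; as `n → -∞` the jumps are at most `1` and the
volume decays geometrically. -/
theorem summable_heatJump_mul (hb : 1 < b) (hα : 0 < α) (hs : 0 < s) :
    Summable fun n : ℤ => heatJump b α s n * b ^ (2 * n) := by
  have hb0 : 0 < b := one_pos.trans hb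
  have hnn : ∀ n : ℤ, 0 ≤ heatJump b α s n * b ^ (2 * n) := fun n =>
    mul_nonneg (heatJump_nonneg hb hα hs n) (by positivity)
  have hbi : b⁻¹ < 1 := inv_lt_one_of_one_lt₀ hb
  have hgeo : Summable fun n : ℕ => (b⁻¹) ^ n := summable_geometric_of_lt_one (by positivity) hbi
  refine Summable.of_nat_of_neg ?_ ?_
  · obtain ⟨C, hC⟩ := exp_le_inv_pow hb hα hs
    refine Summable.of_nonneg_of_le (fun n => hnn n) (fun n => ?_) (hgeo.mul_left C)
    refine le_trans ?_ (hC n)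
    have e : b ^ (2 * (n : ℤ)) = b ^ (2 * n) := by norm_cast
    rw [e]
    refine mul_le_mul_of_nonneg_right ?_ (by positivity)
    rw [heatJump, zpow_natCast]
    linarith [Real.exp_pos (-s * (b ^ ((n : ℤ) + 1)) ^ α)]
  · refine Summable.of_nonneg_of_le (fun n => hnn _) (fun n => ?_) hgeo
    have h₁ : heatJump b α s (-n) ≤ 1 := by
      have h : Real.exp (-s * (b ^ (-(n : ℤ))) ^ α) ≤ 1 := by
        rw [Real.exp_le_one_iff, neg_mul]
        exact neg_nonpos.2 (by positivity)
      rw [heatJump]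
      linarith [Real.exp_pos (-s * (b ^ (-(n : ℤ) + 1)) ^ α)]
    have h₂ : b ^ (2 * (-(n : ℤ))) ≤ (b⁻¹) ^ n := by
      rw [inv_pow, ← zpow_natCast, ← zpow_neg]
      exact zpow_le_zpow_right₀ hb.le (by omega)
    calc _ ≤ 1 * b ^ (2 * (-(n : ℤ))) := mul_le_mul_of_nonneg_right h₁ (by positivity)
      _ ≤ _ := by rwa [one_mul]

/-- The sum telescopes, and the exponential tends to `0` at infinity. -/
theorem hasSum_heatJump (hb : 1 < b) (hα : 0 < α) (hs : 0 < s) (m : ℤ) :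
    HasSum (fun n : ℤ => if m ≤ n then heatJump b α s n else 0) (Real.exp (-s * (b ^ m) ^ α)) := by
  have hb0 : 0 < b := one_pos.trans hb
  have hinj : Function.Injective fun i : ℕ => m + (i : ℤ) := fun i j h => by simpa using h
  rw [← hinj.hasSum_iff]
  · have hterm : ((fun n : ℤ => if m ≤ n then heatJump b α s n else 0) ∘ fun i : ℕ => m + (i : ℤ)) =
        fun i : ℕ => Real.exp (-s * (b ^ (m + (i : ℤ))) ^ α) -
          Real.exp (-s * (b ^ (m + ((i + 1 : ℕ) : ℤ))) ^ α) := by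
      ext i
      simp [heatJump, add_assoc]
    rw [hterm, hasSum_iff_tendsto_nat_of_nonneg]
    · simp only [Finset.sum_range_sub' fun i : ℕ => Real.exp (-s * (b ^ (m + (i : ℤ))) ^ α)]
      have hlim : Filter.Tendsto (fun i : ℕ => Real.exp (-s * (b ^ (m + (i : ℤ))) ^ α))
          Filter.atTop (nhds 0) := by
        have h₁ : Filter.Tendsto (fun i : ℕ => b ^ (m + (i : ℤ))) Filter.atTop Filter.atTop := by
          simp only [zpow_add₀ hb0.ne', zpow_natCast]
          exact (tendsto_pow_atTop_atTop_of_one_lt hb).const_mul_atTop (by positivity)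
        have h₂ := ((tendsto_rpow_atTop hα).comp h₁).const_mul_atTop hs
        have h₃ := Real.tendsto_exp_neg_atTop_nhds_zero.comp h₂
        simpa [Function.comp_def] using h₃
      simpa using hlim.const_sub (Real.exp (-s * (b ^ (m + ((0 : ℕ) : ℤ))) ^ α))
    · intro i
      have := heatJump_nonneg hb hα hs (m + i)
      simpa [heatJump, add_assoc] using this
  · intro n hn
    rw [if_neg]
    intro h
    exact hn ⟨(n - m).toNat, by simp only; omega⟩

/-- Expand both exponentials of `heatJump` and interchange the summations. -/
theorem hasSum_heatJump_expansion (hb : 1 < b) (hα : 0 < α) (N : ℤ) {Z : ℝ}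
    (hZ : HasSum (fun n : ℤ => if n ≤ N then heatJump b α s n * b ^ (2 * n) else 0) Z) :
    HasSum (fun m : ℕ => (-s * (b ^ N) ^ α) ^ (m + 1) / (m + 1).factorial *
      (1 - (b ^ α) ^ (m + 1)) * b ^ (2 * N) *
      (1 - ((b ^ α)⁻¹) ^ (m + 1) * (b⁻¹) ^ 2)⁻¹) Z := by
  have hb0 : 0 < b := one_pos.trans hb
  set Y := (b ^ N) ^ α with hY
  set P := b ^ α with hP
  have hP1 : 1 < P := Real.one_lt_rpow hb hα
  have hP0 : 0 < P := one_pos.trans hP1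
  have hbi : b⁻¹ < 1 := inv_lt_one_of_one_lt₀ hb
  have hbi0 : 0 < b⁻¹ := by positivity
  have hPi : P⁻¹ < 1 := inv_lt_one_of_one_lt₀ hP1
  have hPi0 : 0 < P⁻¹ := by positivity
  -- `C m` is the term of order `m + 1` in the expansion of `heatJump N * b ^ (2N)`. Passing from
  -- `N` to `N - i` multiplies it by the `i`-th power of a ratio below `1`, which gives the double
  -- family `T`.
  set C : ℕ → ℝ := fun m => (-s * Y) ^ (m + 1) / (m + 1).factorial *
    (1 - P ^ (m + 1)) * b ^ (2 * N) with hC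
  set T : ℕ × ℕ → ℝ := fun q => C q.1 * ((P⁻¹) ^ (q.1 + 1) * (b⁻¹) ^ 2) ^ q.2 with hT
  have hCsum : ∀ x : ℝ, HasSum (fun m : ℕ => (x ^ (m + 1) / (m + 1).factorial) * (1 - P ^ (m + 1)))
      (Real.exp x - Real.exp (x * P)) := by
    intro x
    have h := (hasSum_exp_sub_one x).sub
      (hasSum_exp_sub_one (x * P))
    rw [sub_sub_sub_cancel_right] at h
    refine h.congr_fun fun m => ?_
    rw [mul_pow]
    ring
  have hTsum : Summable T := by
    have hC' : Summable C := ((hCsum (-s * Y)).mul_right (b ^ (2 * N))).summable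
    have hgeo : Summable fun i : ℕ => ((b⁻¹) ^ 2) ^ i :=
      summable_geometric_of_lt_one (by positivity) (pow_lt_one₀ hbi0.le hbi two_ne_zero)
    -- The ratio is at most `b⁻²` for every order, so a product of two summable families dominates
    -- `T` and justifies the interchange.
    refine Summable.of_norm_bounded (hC'.abs.mul_of_nonneg hgeo (fun _ => abs_nonneg _)
      fun _ => by positivity) fun q => ?_
    rw [hT, Real.norm_eq_abs, abs_mul]
    refine mul_le_mul_of_nonneg_left ?_ (abs_nonneg _)
    rw [abs_of_nonneg (by positivity)]
    refine pow_le_pow_left₀ (by positivity) ?_ _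
    exact mul_le_of_le_one_left (by positivity) (pow_le_one₀ hPi0.le hPi.le)
  have hrow : HasSum (fun m : ℕ => C m * (1 - (P⁻¹) ^ (m + 1) * (b⁻¹) ^ 2)⁻¹) (∑' q, T q) := by
    refine hTsum.hasSum.prod_fiberwise fun m => ?_
    refine (hasSum_geometric_of_lt_one (by positivity) ?_).mul_left (C m)
    exact mul_lt_one_of_nonneg_of_lt_one_left (by positivity)
      (pow_lt_one₀ hPi0.le hPi (by omega)) (pow_le_one₀ hbi0.le hbi.le)
  have hcol : HasSum (fun i : ℕ => heatJump b α s (N - i) * b ^ (2 * (N - (i : ℤ))))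
      (∑' q, T q) := by
    have hswap : HasSum (fun q : ℕ × ℕ => T q.swap) (∑' q, T q) :=
      (Equiv.prodComm ℕ ℕ).hasSum_iff.2 hTsum.hasSum
    refine hswap.prod_fiberwise fun i => ?_
    have hy : (b ^ (N - (i : ℤ))) ^ α = Y * (P⁻¹) ^ i := by
      rw [zpow_sub₀ hb0.ne', zpow_natCast, Real.div_rpow (by positivity) (by positivity), inv_pow,
        hP, Real.rpow_pow_comm hb0.le, div_eq_mul_inv]
    have hy' : (b ^ (N - (i : ℤ) + 1)) ^ α = Y * (P⁻¹) ^ i * P := by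
      rw [zpow_add_one₀ hb0.ne', Real.mul_rpow (by positivity) hb0.le, hy]
    have hb2 : b ^ (2 * (N - (i : ℤ))) = b ^ (2 * N) * ((b⁻¹) ^ 2) ^ i := by
      rw [mul_sub, zpow_sub₀ hb0.ne', ← pow_mul, inv_pow, div_eq_mul_inv]
      norm_cast
    have h := (hCsum (-s * (Y * (P⁻¹) ^ i))).mul_right (b ^ (2 * (N - (i : ℤ))))
    rw [heatJump, hy, hy', ← mul_assoc (-s) (Y * (P⁻¹) ^ i) P]
    refine h.congr_fun fun m => ?_
    simp only [hT, hC, Prod.swap, hb2]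
    rw [← mul_assoc (-s), mul_pow (-s * Y), mul_pow ((P⁻¹) ^ (m + 1)),
      pow_right_comm (P⁻¹) (m + 1) i]
    ring
  have hZ' : HasSum (fun i : ℕ => heatJump b α s (N - i) * b ^ (2 * (N - (i : ℤ)))) Z := by
    have hinj : Function.Injective fun i : ℕ => N - (i : ℤ) := fun i j h => by simpa using h
    refine ((hinj.hasSum_iff ?_).2 hZ).congr_fun fun i => ?_
    · intro n hn
      rw [if_neg]
      intro h
      exact hn ⟨(N - n).toNat, by simp only; omega⟩
    · simp
  rw [hZ'.unique hcol]
  exact hrow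

end Jump

/-! ### Decomposition of the heat kernel into lattice layers. -/

section Kernel

variable {p : ℕ} [Fact p.Prime] {a : ℤ} (ha : ¬ IsSquare (a : ZMod p)) {α κ t : ℝ}

theorem continuous_heatIntegrand (a : ℤ) (hα : 0 < α) (x : Space p) :
    Continuous (heatIntegrand a α κ x t) := by
  have h : Continuous fun ξ : Space p => ‖dualForm a ξ‖ ^ α :=
    (continuous_dualForm a).norm.rpow_const fun _ => Or.inr hα.le
  exact (continuous_chi_pairing x).mul (Complex.continuous_ofReal.comp
    (Real.continuous_exp.comp (continuous_const.mul h)))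

/-- The part of the heat integrand that lives on the lattice `dualBall ha n`. -/
def heatLayer (α s : ℝ) (x : Space p) (n : ℤ) : Space p → ℂ :=
  (dualBall ha n : Set (Space p)).indicator
    fun ξ => (heatJump p α s n : ℂ) * chi (∑ i, ξ i * x i)

theorem norm_heatLayer (hα : 0 < α) {s : ℝ} (hs : 0 < s) (x : Space p) (n : ℤ) (ξ : Space p) :
    ‖heatLayer ha α s x n ξ‖ =
      (dualBall ha n : Set (Space p)).indicator (fun _ => heatJump p α s n) ξ := by
  have h := heatJump_nonneg (one_lt_cast_prime p) hα hs n
  rw [heatLayer, norm_indicator_eq_indicator_norm]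
  simp only [norm_mul, norm_chi, mul_one, Complex.norm_real, Real.norm_of_nonneg h]

/-- If `|f°(ξ)| = p ^ m`, then `ξ` lies in exactly the lattices with `n ≥ m`, whose jumps telescope
to the value of the exponential. The origin, where no such `m` exists, is a null set. -/
theorem hasSum_heatLayer (hα : 0 < α) (hs : 0 < κ * t) (x : Space p) {ξ : Space p} (hξ : ξ ≠ 0) :
    HasSum (fun n : ℤ => heatLayer ha α (κ * t) x n ξ) (heatIntegrand a α κ x t ξ) := by
  have hp := one_lt_cast_prime p
  have hd : dualForm a ξ ≠ 0 := by
    rw [dualForm_eq_form_rev, ← norm_ne_zero_iff]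
    refine (norm_form_pos ha fun h => hξ (funext fun i => ?_)).ne'
    simpa using congrFun h i.rev
  obtain ⟨m, hm⟩ := exists_norm_eq_zpow hd
  have h := (Complex.hasSum_ofReal.2 (hasSum_heatJump hp hα hs m)).mul_left (chi (∑ i, ξ i * x i))
  rw [heatIntegrand, hm, neg_mul κ t]
  refine h.congr_fun fun n => ?_
  have hiff : ξ ∈ (dualBall ha n : Set (Space p)) ↔ m ≤ n := by
    rw [SetLike.mem_coe, mem_dualBall, hm, zpow_le_zpow_iff_right₀ hp]
  by_cases hmn : m ≤ n
  · rw [heatLayer, Set.indicator_of_mem (hiff.2 hmn), if_pos hmn, mul_comm]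
  · rw [heatLayer, Set.indicator_of_notMem (fun h' => hmn (hiff.1 h')), if_neg hmn]
    simp

theorem haar_dualBall_lt_top (n : ℤ) : haar p (dualBall ha n) < ⊤ := by
  rw [haar_dualBall]
  exact ENNReal.ofReal_lt_top

theorem integrable_heatLayer (s : ℝ) (x : Space p) (n : ℤ) :
    Integrable (heatLayer ha α s x n) (haar p) := by
  refine (integrable_indicator_iff (measurableSet_dualBall ha n)).2 ?_
  refine Measure.integrableOn_of_bounded (M := ‖(heatJump p α s n : ℂ)‖)
    (haar_dualBall_lt_top ha n).ne
    (continuous_const.mul (continuous_chi_pairing x)).aestronglyMeasurable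
    (Filter.Eventually.of_forall fun ξ => ?_)
  rw [norm_mul, norm_chi, mul_one]

theorem integral_norm_heatLayer (hα : 0 < α) {s : ℝ} (hs : 0 < s) (x : Space p) (n : ℤ) :
    ∫ ξ, ‖heatLayer ha α s x n ξ‖ ∂(haar p) = heatJump p α s n * (p : ℝ) ^ (2 * n) := by
  simp only [norm_heatLayer ha hα hs]
  rw [integral_indicator (measurableSet_dualBall ha n), setIntegral_const, measureReal_def,
    haar_dualBall, ENNReal.toReal_ofReal (by positivity), smul_eq_mul, mul_comm]

theorem integral_heatLayer (s : ℝ) (x : Space p) (n : ℤ) :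
    ∫ ξ, heatLayer ha α s x n ξ ∂(haar p) = ((if ‖form a x‖ ≤ (p : ℝ) ^ (-n) then
      heatJump p α s n * (p : ℝ) ^ (2 * n) else 0 : ℝ) : ℂ) := by
  rw [heatLayer, integral_indicator (measurableSet_dualBall ha n), integral_const_mul,
    setIntegral_chi]
  split_ifs <;> simp

variable (p) in
theorem ae_ne_zero : ∀ᵐ ξ ∂(haar p), ξ ≠ 0 := by
  have : (nhdsWithin (0 : Space p) {0}ᶜ).NeBot := Module.punctured_nhds_neBot ℚ_[p] (Space p) 0
  have := Measure.IsAddHaarMeasure.nullSingletonClass (haar p)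
  exact Measure.ae_ne (haar p) 0

theorem summable_integral_norm_heatLayer (hα : 0 < α) {s : ℝ} (hs : 0 < s) (x : Space p) :
    Summable fun n : ℤ => ∫ ξ, ‖heatLayer ha α s x n ξ‖ ∂(haar p) := by
  simp only [integral_norm_heatLayer ha hα hs]
  exact summable_heatJump_mul (one_lt_cast_prime p) hα hs

theorem integrable_heatIntegrand {a : ℤ} (ha : ¬ IsSquare (a : ZMod p)) (hα : 0 < α)
    (hs : 0 < κ * t) (x : Space p) :
    Integrable (heatIntegrand a α κ x t) (haar p) := by
  refine ⟨(continuous_heatIntegrand a hα x).aestronglyMeasurable, ?_⟩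
  have hle : ∫⁻ ξ, ‖heatIntegrand a α κ x t ξ‖ₑ ∂(haar p) ≤
      ∑' n : ℤ, ∫⁻ ξ, ‖heatLayer ha α (κ * t) x n ξ‖ₑ ∂(haar p) := by
    rw [← lintegral_tsum fun n => (integrable_heatLayer ha _ x n).1.enorm]
    refine lintegral_mono_ae ?_
    filter_upwards [ae_ne_zero p] with ξ hξ
    rw [← (hasSum_heatLayer ha hα hs x hξ).tsum_eq]
    exact enorm_tsum_le_tsum_enorm
  refine hle.trans_lt ?_
  have hterm : ∀ n : ℤ, ∫⁻ ξ, ‖heatLayer ha α (κ * t) x n ξ‖ₑ ∂(haar p) =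
      ENNReal.ofReal (∫ ξ, ‖heatLayer ha α (κ * t) x n ξ‖ ∂(haar p)) := fun n =>
    (ofReal_integral_norm_eq_lintegral_enorm (integrable_heatLayer ha _ x n)).symm
  simp only [hterm]
  rw [← ENNReal.ofReal_tsum_of_nonneg (fun n => integral_nonneg fun ξ => norm_nonneg _)
    (summable_integral_norm_heatLayer ha hα hs x)]
  exact ENNReal.ofReal_lt_top

/-- Integration term by term is allowed because the `L¹` norms of the layers, `heatJump n * p ^
(2n)`, are summable. All terms are real and nonnegative. -/
theorem hasSum_heatKernel {a : ℤ} (ha : ¬ IsSquare (a : ZMod p)) (hα : 0 < α)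
    (hs : 0 < κ * t) (x : Space p) :
    HasSum (fun n : ℤ => ((if ‖form a x‖ ≤ (p : ℝ) ^ (-n) then
      heatJump p α (κ * t) n * (p : ℝ) ^ (2 * n) else 0 : ℝ) : ℂ)) (heatKernel a α κ x t) := by
  have h := hasSum_integral_of_summable_integral_norm (fun n => integrable_heatLayer ha (κ * t) x n)
    (summable_integral_norm_heatLayer ha hα hs x)
  simp only [integral_heatLayer] at h
  have e : heatKernel a α κ x t = ∫ ξ, ∑' n : ℤ, heatLayer ha α (κ * t) x n ξ ∂(haar p) := by
    refine integral_congr_ae ?_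
    filter_upwards [ae_ne_zero p] with ξ hξ
    exact (hasSum_heatLayer ha hα hs x hξ).tsum_eq.symm
  rwa [e]

theorem heatKernel_im_eq_zero_and_re_nonneg {a : ℤ} (ha : ¬ IsSquare (a : ZMod p)) (hα : 0 < α)
    (hs : 0 < κ * t) (x : Space p) :
    (heatKernel a α κ x t).im = 0 ∧ 0 ≤ (heatKernel a α κ x t).re := by
  obtain ⟨hre, him⟩ := (Complex.hasSum_iff _ _).1 (hasSum_heatKernel ha hα hs x)
  simp only [Complex.ofReal_re, Complex.ofReal_im] at hre him
  refine ⟨him.unique hasSum_zero, hre.nonneg fun n => ?_⟩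
  have := heatJump_nonneg (one_lt_cast_prime p) hα hs n
  split_ifs <;> positivity

theorem hasSum_heatKernel_series {a : ℤ} (ha : ¬ IsSquare (a : ZMod p)) (hα : 0 < α)
    (hs : 0 < κ * t) {x : Space p} (hx : x ≠ 0) :
    HasSum
      (fun m : ℕ =>
        (((-1 : ℝ) ^ (m + 1) / ((m + 1).factorial : ℝ) *
            ((1 - (p : ℝ) ^ (α * ((m + 1 : ℕ) : ℝ))) /
              (1 - (p : ℝ) ^ (-α * ((m + 1 : ℕ) : ℝ) - 2))) *
            κ ^ (m + 1) * t ^ (m + 1) *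
            ‖form a x‖ ^ (-α * ((m + 1 : ℕ) : ℝ) - 2) : ℝ) : ℂ))
      (heatKernel a α κ x t) := by
  have hp := one_lt_cast_prime p
  have hp0 : (0 : ℝ) < p := one_pos.trans hp
  obtain ⟨k, hk⟩ := exists_norm_eq_zpow (norm_pos_iff.1 (norm_form_pos ha hx))
  have hre := ((Complex.hasSum_iff _ _).1 (hasSum_heatKernel ha hα hs x)).1
  have him := (heatKernel_im_eq_zero_and_re_nonneg ha hα hs x).1
  have hZ : heatKernel a α κ x t = ((heatKernel a α κ x t).re : ℂ) :=
    Complex.ext rfl (by rw [him, Complex.ofReal_im])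
  rw [hZ, Complex.hasSum_ofReal]
  have hiff : ∀ n : ℤ, (p : ℝ) ^ k ≤ (p : ℝ) ^ (-n) ↔ n ≤ -k := fun n => by
    rw [zpow_le_zpow_iff_right₀ hp]
    omega
  simp only [Complex.ofReal_re, hk, hiff] at hre
  -- With `|f(x)| = p ^ k` the surviving layers are those with `n ≤ -k`, so `b ^ N = |f(x)|⁻¹`,
  -- which accounts for the power `|f(x)| ^ (-αm - 2)`.
  refine (hasSum_heatJump_expansion hp hα (-k) hre).congr_fun fun m => ?_
  have e₁ : (p : ℝ) ^ (α * ((m + 1 : ℕ) : ℝ)) = ((p : ℝ) ^ α) ^ (m + 1) :=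
    Real.rpow_mul_natCast hp0.le _ _
  have e₂ : ∀ r : ℝ, 0 < r → r ^ (-α * ((m + 1 : ℕ) : ℝ) - 2) =
      ((r ^ α)⁻¹) ^ (m + 1) * (r⁻¹) ^ 2 := fun r hr => by
    rw [Real.rpow_sub hr, Real.rpow_mul_natCast hr.le, Real.rpow_neg hr.le, Real.rpow_two,
      div_eq_mul_inv, inv_pow r 2]
  have e₃ : ((p : ℝ) ^ (-k)) ^ α = (((p : ℝ) ^ k) ^ α)⁻¹ := by
    rw [zpow_neg, Real.inv_rpow (by positivity)]
  have e₄ : (p : ℝ) ^ (2 * -k) = (((p : ℝ) ^ k)⁻¹) ^ 2 := by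
    rw [← zpow_neg, mul_comm, zpow_mul]
    norm_cast
  rw [e₁, hk, e₂ _ hp0, e₂ _ (by positivity : (0 : ℝ) < (p : ℝ) ^ k), e₃, e₄, mul_pow (-(κ * t)),
    neg_pow (κ * t), mul_pow κ t]
  ring

theorem add_ne_zero_of_norm_lt {x ξ : Space p} (h : ‖ξ‖ < (p : ℝ)⁻¹ * ‖x‖) : x + ξ ≠ 0 := by
  intro h0
  have hpi : (p : ℝ)⁻¹ ≤ 1 := inv_le_one_of_one_le₀ (one_lt_cast_prime p).le
  rw [← norm_neg, ← eq_neg_of_add_eq_zero_left h0] at h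
  exact h.not_ge (mul_le_of_le_one_left (norm_nonneg _) hpi)

end Kernel

end PadicHeat

end

theorem proposition1 (p : ℕ) [Fact p.Prime] (hp : p ≠ 2) (a : ℤ)
    (ha : ¬ IsSquare (a : ZMod p)) (α κ : ℝ) (hα : 0 < α) (hκ : 0 < κ) :
    -- (i)
    (∀ x ξ : PadicHeat.Space p, x ≠ 0 → ‖ξ‖ < (p : ℝ)⁻¹ * ‖x‖ →
      ‖PadicHeat.form a (x + ξ)‖ = ‖PadicHeat.form a x‖) ∧
    -- the integral that defines the heat kernel converges absolutely
    (∀ (x : PadicHeat.Space p) (t : ℝ), 0 < t →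
      MeasureTheory.Integrable (PadicHeat.heatIntegrand a α κ x t) (PadicHeat.haar p)) ∧
    -- (ii), the summand with index `m : ℕ` being the term of order `m + 1`
    (∀ (x : PadicHeat.Space p) (t : ℝ), x ≠ 0 → 0 < t →
      HasSum
        (fun m : ℕ =>
          (((-1 : ℝ) ^ (m + 1) / ((m + 1).factorial : ℝ) *
              ((1 - (p : ℝ) ^ (α * ((m + 1 : ℕ) : ℝ))) /
                (1 - (p : ℝ) ^ (-α * ((m + 1 : ℕ) : ℝ) - 2))) *
              κ ^ (m + 1) * t ^ (m + 1) *
              ‖PadicHeat.form a x‖ ^ (-α * ((m + 1 : ℕ) : ℝ) - 2) : ℝ) : ℂ))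
        (PadicHeat.heatKernel a α κ x t)) ∧
    -- (iii)
    (∀ (x ξ : PadicHeat.Space p) (t : ℝ), x ≠ 0 → 0 < t → ‖ξ‖ < (p : ℝ)⁻¹ * ‖x‖ →
      PadicHeat.heatKernel a α κ (x + ξ) t = PadicHeat.heatKernel a α κ x t) ∧
    -- (iv)
    (∀ (x : PadicHeat.Space p) (t : ℝ), 0 < t →
      (PadicHeat.heatKernel a α κ x t).im = 0 ∧ 0 ≤ (PadicHeat.heatKernel a α κ x t).re) := by
  refine ⟨fun x ξ _ h => PadicHeat.norm_form_add_eq ha h,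
    fun x t ht => PadicHeat.integrable_heatIntegrand ha hα (mul_pos hκ ht) x,
    fun x t hx ht => PadicHeat.hasSum_heatKernel_series ha hα (mul_pos hκ ht) hx,
    fun x ξ t hx ht h => ?_,
    fun x t ht => PadicHeat.heatKernel_im_eq_zero_and_re_nonneg ha hα (mul_pos hκ ht) x⟩
  -- By (i), the series at `x + ξ` and at `x` coincide term by term, so their sums agree.
  have h₁ := PadicHeat.hasSum_heatKernel_series ha hα (mul_pos hκ ht)
    (PadicHeat.add_ne_zero_of_norm_lt h)
  rw [PadicHeat.norm_form_add_eq ha h] at h₁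
  exact h₁.unique (PadicHeat.hasSum_heatKernel_series ha hα (mul_pos hκ ht) hx)
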